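/- Let $n > s$ be positive integers and let $t_0,\dots,t_s \in \mathbb{R}$ with $t_s \neq 0$ be such that $g(x)=\sum_{k=0}^{s} t_{s-k}x^{s-k}$, a real polynomial of degree $s$, is separable (i.e. has no multiple complex root). Put $$f(t,x) = x^n + t\,g(x) = x^n + t\sum_{k=0}^{s} t_{s-k}x^{s-k},$$ and let $\Delta_{f,x}(t)$ be the discriminant of $f(t,x)$ with respect to $x$. Then $t^{n-1}$ divides $\Delta_{f,x}(t)$ in $\mathbb{R}[t]$, and $$P(t) = \frac{1}{t^{n-1}}\,\Delta_{f,x}(t)$$ is a polynomial of degree $s$ in $t$. For a nonzero real polynomial $h$ let $N_h$ denote the number of distinct real roots of $h$, and put $\gamma = N_g$. Let $\xi$ be a real number such that $\xi > |\beta_m|$, where $\beta_1<\dots<\beta_m$ are the distinct real roots of $P$ (so $\beta_m$ is the largest real root); if $P$ has no real root, let $\xi$ be any real number with $\xi > 0$. Then $$N_{f(\xi,x)} = \begin{cases} \gamma+1 & \text{if } n-s \text{ is odd},\\ \gamma & \text{if } n-s \text{ is even and } t_s>0,\\ \gamma+2 & \text{if } n-s \text{ is even and } t_s<0.\end{cases}$$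 -/

import Mathlib

open Polynomial

namespace RealRootCount

noncomputable section

/-- The polynomial `g(x) = ∑_{k=0}^{s} t_{s-k} x^{s-k} = t_s x^s + ⋯ + t_1 x + t_0`. -/
def gPoly {s : ℕ} (c : Fin (s + 1) → ℝ) : ℝ[X] :=
  ∑ k : Fin (s + 1), C (c k) * X ^ (k : ℕ)

/-- The polynomial `f(t, x) = x^n + t g(x)`, as a polynomial in the outer variable `x` over the ring
`ℝ[t]` (contained in `ℝ(t)`), in which it has its coefficients. -/
def fPoly (n : ℕ) {s : ℕ} (c : Fin (s + 1) → ℝ) : ℝ[X][X] :=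
  X ^ n + C X * (gPoly c).map C

/-- The real polynomial `f(ξ, x)` obtained by setting `t = ξ`. -/
def fAt (n : ℕ) {s : ℕ} (c : Fin (s + 1) → ℝ) (ξ : ℝ) : ℝ[X] :=
  (fPoly n c).map (evalRingHom ξ)

/-- The discriminant of `f(t, x)` with respect to `x`, a polynomial in `t`. -/
def discF (n : ℕ) {s : ℕ} (c : Fin (s + 1) → ℝ) : ℝ[X] :=
  (fPoly n c).discr

/-- The quotient `P(t)` of the discriminant by `t^(n-1)`. -/
def P (n : ℕ) {s : ℕ} (c : Fin (s + 1) → ℝ) : ℝ[X] :=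
  discF n c /ₘ X ^ (n - 1)

/-- The number of distinct real roots of a nonzero real polynomial. -/
def numRealRoots (p : ℝ[X]) : ℕ :=
  {x : ℝ | p.eval x = 0}.ncard

end

end RealRootCount

/-! Write `f = x^n + t g` and `H = n g - x g'` (`polarPoly`). From `n f = t H + x f'`, the resultant
of `f'` and `f` is `t^(n-1)` times that of `f'` and `H`, up to nonzero constants. Over `ℂ` the
latter is, up to a constant, the product of `f'(α) = n α^(n-1) + t g'(α)` over the roots `α` of `H`.
Separability of `g` makes every factor linear in `t`, so `P` has degree `deg H = s`.

For `u ≥ ξ` neither `u` nor `P(u)` is zero, so all real roots of `f(u, x)` are simple and their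
number is locally constant, hence constant, on `[ξ, ∞)`. It is read off for large `u`: on a fixed
large interval, `g + x^n / u` has as many roots as `g`; beyond each end there is one more root or
none, according to the sign of `g` there (`eventually_ncard_roots_Ioi`,
`eventually_ncard_roots_Iio`). -/

open Filter Topology

/-! ### Persistence of simple real zeros -/

/-- A simple zero of a member of a pencil of real polynomials persists, uniquely, in every small
interval around it. -/
theorem eventually_existsUnique_root (A B : ℝ[X]) (u₀ r : ℝ)
    (hr : (A + C u₀ * B).eval r = 0) (hr' : (A + C u₀ * B).derivative.eval r ≠ 0) :
    ∀ᶠ δ in 𝓝[>] (0 : ℝ), ∀ᶠ u in 𝓝 u₀,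
      ∃! x, x ∈ Set.Icc (r - δ) (r + δ) ∧ (A + C u * B).eval x = 0 := by
  wlog hpos : 0 < (A + C u₀ * B).derivative.eval r generalizing A B with H
  · have h := H (-A) (-B) (by simp at hr ⊢; linarith)
      (by simp at hr' ⊢; intro h; apply hr'; linarith)
      (by
        have := lt_of_le_of_ne (not_lt.mp hpos) hr'
        simp at this ⊢; linarith)
    filter_upwards [h] with δ hδ
    filter_upwards [hδ] with u hu
    refine (existsUnique_congr fun x => ?_).mp hu
    simp only [eval_add, eval_neg, eval_mul, eval_C, and_congr_right_iff]
    intro _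
    constructor <;> intro h <;> linarith
  have hcont : Continuous fun p : ℝ × ℝ => (A + C p.1 * B).derivative.eval p.2 := by
    simp only [derivative_add, derivative_mul, derivative_C, zero_mul, zero_add, eval_add, eval_mul,
      eval_C]
    fun_prop
  have hcont' : ∀ x, Continuous fun u : ℝ => (A + C u * B).eval x := by
    intro x
    simp only [eval_add, eval_mul, eval_C]
    fun_prop
  -- Joint continuity gives one interval around `r` on which every nearby member is strictly
  -- increasing.
  have hev : ∀ᶠ p in 𝓝 u₀ ×ˢ 𝓝 r, 0 < (A + C p.1 * B).derivative.eval p.2 := by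
    rw [← nhds_prod_eq]
    exact (hcont.tendsto (u₀, r)).eventually (lt_mem_nhds hpos)
  obtain ⟨p, hp, q, hq, hpq⟩ := eventually_prod_iff.mp hev
  obtain ⟨ε, hε, hball⟩ := Metric.eventually_nhds_iff.mp hq
  have hmono : ∀ δ, 0 < δ → δ < ε → ∀ u, p u →
      StrictMonoOn (fun x => (A + C u * B).eval x) (Set.Icc (r - δ) (r + δ)) := by
    intro δ hδ hδε u hu
    refine strictMonoOn_of_deriv_pos (convex_Icc _ _) (by fun_prop) ?_
    intro x hx
    rw [interior_Icc] at hx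
    rw [Polynomial.deriv]
    refine hpq hu (hball ?_)
    rw [Real.dist_eq, abs_lt]
    constructor <;> linarith [hx.1, hx.2]
  filter_upwards [Ioo_mem_nhdsGT hε] with δ hδ
  have h0 := hmono δ hδ.1 hδ.2 u₀ hp.self_of_nhds
  have hl : (A + C u₀ * B).eval (r - δ) < 0 := by
    rw [← hr]
    exact h0 ⟨le_rfl, by linarith [hδ.1]⟩ ⟨by linarith [hδ.1], by linarith [hδ.1]⟩
      (by linarith [hδ.1])
  have hu : 0 < (A + C u₀ * B).eval (r + δ) := by
    rw [← hr]
    exact h0 ⟨by linarith [hδ.1], by linarith [hδ.1]⟩ ⟨by linarith [hδ.1], le_rfl⟩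
      (by linarith [hδ.1])
  filter_upwards [hp, (hcont' (r - δ)).continuousAt.eventually (gt_mem_nhds hl),
    (hcont' (r + δ)).continuousAt.eventually (lt_mem_nhds hu)] with u hpu hlu huu
  obtain ⟨x, hx, hx0⟩ := intermediate_value_Icc (f := fun x => (A + C u * B).eval x)
    (by linarith [hδ.1] : r - δ ≤ r + δ) (by fun_prop) ⟨hlu.le, huu.le⟩
  refine ⟨x, ⟨hx, hx0⟩, fun y hy => ?_⟩
  exact (hmono δ hδ.1 hδ.2 u hpu).injOn hy.1 hx (hy.2.trans hx0.symm)

/-- The number of zeros in a compact interval is locally constant along a pencil of real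
polynomials, at a member all of whose zeros in the interval are simple and interior. -/
theorem eventually_ncard_roots_Icc_eq (A B : ℝ[X]) (u₀ a b : ℝ)
    (ha : (A + C u₀ * B).eval a ≠ 0) (hb : (A + C u₀ * B).eval b ≠ 0)
    (hsimple : ∀ x ∈ Set.Icc a b, (A + C u₀ * B).eval x = 0 →
      (A + C u₀ * B).derivative.eval x ≠ 0) :
    ∀ᶠ u in 𝓝 u₀, {x | x ∈ Set.Icc a b ∧ (A + C u * B).eval x = 0}.ncard =
      {x | x ∈ Set.Icc a b ∧ (A + C u₀ * B).eval x = 0}.ncard := by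
  set S := {x | x ∈ Set.Icc a b ∧ (A + C u₀ * B).eval x = 0} with hS
  have hne : A + C u₀ * B ≠ 0 := by
    rintro h
    simp [h] at ha
  have hfin : S.Finite := (Polynomial.finite_setOfPred_isRoot hne).subset fun x hx => hx.2
  have h1 : ∀ᶠ δ in 𝓝[>] (0 : ℝ), ∀ r ∈ S, ∀ᶠ u in 𝓝 u₀,
      ∃! x, x ∈ Set.Icc (r - δ) (r + δ) ∧ (A + C u * B).eval x = 0 :=
    (eventually_all_finite hfin).mpr fun r hr =>
      eventually_existsUnique_root A B u₀ r hr.2 (hsimple r hr.1 hr.2)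
  have h2 : ∀ᶠ δ in 𝓝[>] (0 : ℝ), ∀ r ∈ S, δ < r - a ∧ δ < b - r := by
    refine (eventually_all_finite hfin).mpr fun r hr => ?_
    have hra : 0 < r - a := sub_pos.mpr (lt_of_le_of_ne hr.1.1 (by rintro rfl; exact ha hr.2))
    have hrb : 0 < b - r := sub_pos.mpr (lt_of_le_of_ne hr.1.2 (by rintro rfl; exact hb hr.2))
    filter_upwards [Ioo_mem_nhdsGT hra, Ioo_mem_nhdsGT hrb] with δ h h'
    exact ⟨h.2, h'.2⟩
  have h3 : ∀ᶠ δ in 𝓝[>] (0 : ℝ), ∀ r ∈ S, ∀ r' ∈ S, r ≠ r' → 2 * δ < |r - r'| := by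
    refine (eventually_all_finite hfin).mpr fun r hr => (eventually_all_finite hfin).mpr
      fun r' hr' => ?_
    by_cases h : r = r'
    · simp [h]
    · have : 0 < |r - r'| / 2 := by have := abs_pos.mpr (sub_ne_zero.mpr h); positivity
      filter_upwards [Ioo_mem_nhdsGT this] with δ h' _
      linarith [h'.2]
  obtain ⟨δ, hδ0, hδ1, hδ2, hδ3⟩ :=
    (eventually_mem_nhdsWithin.and (h1.and (h2.and h3))).exists
  have hδpos : 0 < δ := hδ0
  -- No zero appears away from `S`: the rest of `[a, b]` is compact and the member at `u₀` does not
  -- vanish on it.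
  have hout : ∀ᶠ u in 𝓝 u₀, ∀ x ∈ Set.Icc a b \ ⋃ r ∈ S, Set.Ioo (r - δ) (r + δ),
      (A + C u * B).eval x ≠ 0 := by
    have hK : IsCompact (Set.Icc a b \ ⋃ r ∈ S, Set.Ioo (r - δ) (r + δ)) :=
      isCompact_Icc.diff (isOpen_biUnion fun _ _ => isOpen_Ioo)
    refine hK.eventually_forall_of_forall_eventually fun x hx => ?_
    have hc : Continuous fun p : ℝ × ℝ => (A + C p.1 * B).eval p.2 := by
      simp only [eval_add, eval_mul, eval_C]
      fun_prop
    refine hc.continuousAt.eventually_ne ?_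
    intro h0
    refine hx.2 (Set.mem_biUnion (show x ∈ S from ⟨hx.1, h0⟩) ⟨?_, ?_⟩) <;> linarith
  filter_upwards [(eventually_all_finite hfin).mpr hδ1, hout] with u hu hout
  choose! ρ hρ hρu using hu
  refine (Set.BijOn.ncard_eq (f := ρ) ⟨fun r hr => ?_, fun r hr r' hr' h => ?_, ?_⟩).symm
  · have := hδ2 r hr
    refine ⟨⟨?_, ?_⟩, (hρ r hr).2⟩ <;> linarith [(hρ r hr).1.1, (hρ r hr).1.2]
  · by_contra hne
    have h1 := (hρ r hr).1
    have h2 := (hρ r' hr').1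
    rw [h] at h1
    refine (hδ3 r hr r' hr' hne).not_ge (abs_le.mpr ⟨?_, ?_⟩) <;>
      linarith [h1.1, h1.2, h2.1, h2.2]
  · intro x hx
    by_cases hx' : x ∈ ⋃ r ∈ S, Set.Ioo (r - δ) (r + δ)
    · obtain ⟨r, hr, hxr⟩ := Set.mem_iUnion₂.mp hx'
      exact ⟨r, hr, (hρu r hr x ⟨Set.Ioo_subset_Icc_self hxr, hx.2⟩).symm⟩
    · exact absurd hx.2 (hout x ⟨hx.1, hx'⟩)

/-! ### The polar polynomial and the zeros outside a large interval -/

/-- `n g - x g'`, the polynomial with `n f - x f' = t (n g - x g')` for `f = x ^ n + t g`. -/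
noncomputable def polarPoly {R : Type*} [CommRing R] (n : ℕ) (g : R[X]) : R[X] :=
  C (n : R) * g - X * derivative g

theorem coeff_polarPoly {R : Type*} [CommRing R] (n : ℕ) (g : R[X]) (k : ℕ) :
    (polarPoly n g).coeff k = ((n : R) - k) * g.coeff k := by
  cases k with
  | zero => simp [polarPoly]
  | succ k => simp [polarPoly, coeff_X_mul, coeff_derivative]; ring

theorem natDegree_polarPoly {K : Type*} [Field K] [CharZero K] {n : ℕ} {g : K[X]} (hg : g ≠ 0)
    (hn : g.natDegree < n) : (polarPoly n g).natDegree = g.natDegree := by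
  refine natDegree_eq_of_le_of_coeff_ne_zero ?_ ?_
  · refine natDegree_le_iff_coeff_eq_zero.mpr fun k hk => ?_
    rw [coeff_polarPoly, coeff_eq_zero_of_natDegree_lt hk, mul_zero]
  · rw [coeff_polarPoly]
    refine mul_ne_zero (sub_ne_zero.mpr ?_) (leadingCoeff_ne_zero.mpr hg)
    exact_mod_cast hn.ne'

theorem polarPoly_ne_zero {K : Type*} [Field K] [CharZero K] {n : ℕ} {g : K[X]} (hg : g ≠ 0)
    (hn : g.natDegree < n) : polarPoly n g ≠ 0 := by
  intro h
  have := coeff_polarPoly n g g.natDegree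
  rw [h, coeff_zero, zero_eq_mul] at this
  rcases this with h | h
  · rw [sub_eq_zero] at h
    exact hn.ne' (by exact_mod_cast h)
  · exact hg (leadingCoeff_eq_zero.mp h)

theorem map_polarPoly {R S : Type*} [CommRing R] [CommRing S] (φ : R →+* S) (n : ℕ) (g : R[X]) :
    (polarPoly n g).map φ = polarPoly n (g.map φ) := by
  simp [polarPoly, derivative_map]

/-- For `x > 0` a zero solves `g / x^n = -1 / t`. The derivative of `g / x^n` is `-H / x^(n+1)` with
`H = polarPoly n g`, nonzero for large `x`, so by Rolle there is at most one solution. If `g` is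
negative at `R`, the intermediate value theorem supplies it for large `t`; if `g` is positive beyond
`R`, there is none. -/
theorem eventually_ncard_roots_Ioi (n : ℕ) (g : ℝ[X]) (hg : g ≠ 0) (hn : g.natDegree < n) :
    ∀ᶠ R in atTop, ∀ᶠ t in atTop, {x | R < x ∧ (X ^ n + C t * g).eval x = 0}.ncard =
      if g.leadingCoeff < 0 then 1 else 0 := by
  have hlead : ∀ p : ℝ[X], 0 < p.leadingCoeff → ∀ᶠ R in atTop, ∀ x, R ≤ x → 0 < p.eval x := by
    intro p hp
    rcases Nat.eq_zero_or_pos p.natDegree with h | h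
    · obtain ⟨c, rfl⟩ := natDegree_eq_zero.mp h
      exact Eventually.of_forall fun _ _ _ => by simpa using hp
    · exact eventually_forall_ge_atTop.mpr
        ((p.tendsto_atTop_of_leadingCoeff_nonneg (natDegree_pos_iff_degree_pos.mp h)
          hp.le).eventually_gt_atTop 0)
  split_ifs with hneg
  · have hnegg := hlead (-g) (by simpa using hneg)
    have hh := eventually_forall_ge_atTop.mpr
      ((polarPoly n g).eventually_atTop_not_isRoot (polarPoly_ne_zero hg hn))
    filter_upwards [hnegg, hh, eventually_gt_atTop 0] with R hR hhR hR0
    have hgR : g.eval R < 0 := by simpa using hR R le_rfl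
    have hlt : ∀ᶠ t in atTop, R ^ n + t * g.eval R < 0 :=
      (tendsto_atBot_add_const_left _ _ (tendsto_id.atTop_mul_const_of_neg hgR)).eventually_lt_atBot 0
    filter_upwards [hlt, eventually_gt_atTop 0] with t ht ht0
    have hdeg : (C t * g).degree < n :=
      by
      rw [degree_C_mul ht0.ne']
      exact (natDegree_lt_iff_degree_lt hg).mp hn
    have hmonic : (X ^ n + C t * g).Monic := monic_X_pow_add hdeg
    obtain ⟨M, hM, hRM⟩ := ((hlead (X ^ n + C t * g) (by rw [hmonic]; norm_num)).and
      (eventually_gt_atTop R)).exists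
    obtain ⟨x, hx, hx0⟩ := intermediate_value_Icc (f := fun x => (X ^ n + C t * g).eval x) hRM.le
      (by fun_prop) ⟨by simpa using ht.le, (hM M le_rfl).le⟩
    simp only at hx0
    have hRx : R < x := by
      refine lt_of_le_of_ne hx.1 ?_
      rintro rfl
      simp at hx0
      linarith
    rw [Set.ncard_eq_one]
    refine ⟨x, Set.eq_singleton_iff_unique_mem.mpr ⟨⟨hRx, hx0⟩, ?_⟩⟩
    have key : ∀ y z, R < y → y < z → (X ^ n + C t * g).eval y = 0 →
        (X ^ n + C t * g).eval z = 0 → False := by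
      intro y z hy hyz hy0 hz0
      have hval : ∀ w, R < w → (X ^ n + C t * g).eval w = 0 → g.eval w / w ^ n = -1 / t := by
        intro w hw h
        have : w ≠ 0 := (hR0.trans hw).ne'
        simp at h
        field_simp
        linarith
      have hder : ∀ w, R < w → HasDerivAt (fun w => g.eval w / w ^ n)
          ((g.derivative.eval w * w ^ n - g.eval w * (n * w ^ (n - 1))) / (w ^ n) ^ 2) w := by
        intro w hw
        exact (g.hasDerivAt w).div (hasDerivAt_pow n w) (pow_ne_zero _ (hR0.trans hw).ne')
      obtain ⟨c, hc, hc0⟩ := exists_hasDerivAt_eq_zero hyz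
        (fun w hw => (hder w (hy.trans_le hw.1)).continuousAt.continuousWithinAt)
        ((hval y hy hy0).trans (hval z (hy.trans hyz) hz0).symm)
        (fun w hw => hder w (hy.trans hw.1))
      have hRc : R < c := hy.trans hc.1
      have hcpos : c ≠ 0 := (hR0.trans hRc).ne'
      refine hhR c hRc.le ?_
      rw [div_eq_zero_iff, or_iff_left (by positivity)] at hc0
      obtain ⟨m, rfl⟩ : ∃ m, n = m + 1 := ⟨n - 1, by omega⟩
      have : c ^ m * (polarPoly (m + 1) g).eval c = 0 := by
        simp only [polarPoly, eval_sub, eval_mul, eval_C, eval_X, add_tsub_cancel_right] at hc0 ⊢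
        linear_combination -hc0
      exact (mul_eq_zero.mp this).resolve_left (pow_ne_zero _ hcpos)
    intro y hy
    rcases lt_trichotomy x y with h | h | h
    · exact (key x y hRx h hx0 hy.2).elim
    · exact h.symm
    · exact (key y x hy.1 h hy.2 hx0).elim
  · have hpos : 0 < g.leadingCoeff :=
      lt_of_le_of_ne (not_lt.mp hneg) (leadingCoeff_ne_zero.mpr hg).symm
    filter_upwards [hlead g hpos, eventually_gt_atTop 0] with R hR hR0
    filter_upwards [eventually_gt_atTop 0] with t ht
    convert Set.ncard_empty ℝ
    refine Set.eq_empty_iff_forall_notMem.mpr fun x hx => ?_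
    have h1 := hR x hx.1.le
    have h2 : 0 < x := hR0.trans hx.1
    have h3 := hx.2
    simp at h3
    have : 0 < x ^ n + t * g.eval x := by positivity
    linarith

/-- Reflection `x ↦ -x`: up to the factor `(-1)^n`, it replaces `g` by `(-1)^n g(-x)`. -/
theorem eventually_ncard_roots_Iio (n : ℕ) (g : ℝ[X]) (hg : g ≠ 0) (hn : g.natDegree < n) :
    ∀ᶠ R in atTop, ∀ᶠ t in atTop, {x | x < -R ∧ (X ^ n + C t * g).eval x = 0}.ncard =
      if (-1) ^ (n + g.natDegree) * g.leadingCoeff < 0 then 1 else 0 := by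
  have hdeg : (C ((-1 : ℝ) ^ n) * g.comp (-X)).natDegree = g.natDegree := by
    rw [natDegree_C_mul (by simp), natDegree_comp]
    simp
  have hlc : (C ((-1 : ℝ) ^ n) * g.comp (-X)).leadingCoeff =
      (-1) ^ (n + g.natDegree) * g.leadingCoeff := by
    rw [leadingCoeff_mul, leadingCoeff_C, leadingCoeff_comp (by simp)]
    simp [pow_add]
    ring
  have h0 : C ((-1 : ℝ) ^ n) * g.comp (-X) ≠ 0 := by
    rw [← leadingCoeff_ne_zero, hlc]
    simpa using hg
  have key := eventually_ncard_roots_Ioi n _ h0 (hdeg.trans_lt hn)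
  rw [hlc] at key
  filter_upwards [key] with R hR
  filter_upwards [hR] with t ht
  rw [← ht, ← Set.ncard_image_of_injective _ (neg_injective (G := ℝ))]
  congr 1
  ext x
  have hx : (X ^ n + C t * (C ((-1 : ℝ) ^ n) * g.comp (-X))).eval x =
      (-1) ^ n * (X ^ n + C t * g).eval (-x) := by
    have : (-1 : ℝ) ^ n * (-1) ^ n = 1 := by rw [← mul_pow]; simp
    simp only [eval_add, eval_mul, eval_pow, eval_X, eval_C, eval_comp, eval_neg, neg_pow x]
    linear_combination (-x ^ n) * this
  rw [Set.image_neg_eq_neg, Set.mem_neg, Set.mem_ofPred_eq, Set.mem_ofPred_eq, hx, mul_eq_zero,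
    or_iff_right (by simp), neg_lt_neg_iff]

/-! ### The discriminant as a polynomial in `t` -/

/-- Over `ℂ`, the resultant of `n g - x g'` with `∂ₓ (x ^ n + t g)` has degree `deg g` in `t`. -/
theorem natDegree_resultant_derivative_polarPoly_of_complex {n : ℕ} {g : ℂ[X]}
    (hn : g.natDegree < n) (hsep : g.Separable) :
    (((X ^ n + C X * g.map C : ℂ[X][X]).derivative).resultant ((polarPoly n g).map C) (n - 1)
      g.natDegree).natDegree = g.natDegree := by
  have hg : g ≠ 0 := hsep.ne_zero
  set D := (X ^ n + C X * g.map C : ℂ[X][X]).derivative with hD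
  set H := polarPoly n g with hH
  have hHs : H.Splits := IsAlgClosed.splits H
  have hDd : D.natDegree ≤ n - 1 := by
    refine (natDegree_derivative_le _).trans (Nat.sub_le_sub_right ?_ 1)
    refine natDegree_add_le_of_degree_le (natDegree_X_pow_le n) ?_
    refine (natDegree_C_mul_le _ _).trans (natDegree_map_le.trans hn.le)
  have hHd : (H.map (C : ℂ →+* ℂ[X])).natDegree = g.natDegree := by
    rw [natDegree_map_eq_of_injective C_injective, natDegree_polarPoly hg hn]
  have hroots : (H.map (C : ℂ →+* ℂ[X])).roots = H.roots.map C := hHs.roots_map_of_injective C_injective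
  have heval : ∀ α ∈ H.roots, (D.eval (C α)).natDegree = 1 := by
    intro α hα
    have hα0 : H.eval α = 0 := (mem_roots'.mp hα).2
    have hDα : D.eval (C α) = C (n * α ^ (n - 1)) + C (g.derivative.eval α) * X := by
      have h1 : (g.derivative.map C).eval (C α) = C (g.derivative.eval α) := by
        rw [eval_map_apply]
      simp only [hD, derivative_add, derivative_X_pow, derivative_C_mul, derivative_map, eval_add,
        eval_mul, eval_C, eval_pow, eval_X, h1, C_mul, C_pow, map_natCast, Polynomial.eval_natCast]
      ring
    -- If `g'(α) = 0`, then `H(α) = 0` forces `n g(α) = 0`, so `α` would be a multiple root of `g`.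
    have hg' : g.derivative.eval α ≠ 0 := by
      intro h
      have hgα : g.eval α = 0 := by
        simp [hH, polarPoly, h] at hα0
        exact hα0.resolve_left (by omega)
      obtain ⟨a, b, hab⟩ := hsep
      have := congrArg (eval α) hab
      simp [h, hgα] at this
    rw [hDα, add_comm]
    exact natDegree_linear hg'
  rw [resultant_comm, ← hHd, resultant_eq_prod_eval _ _ _ hDd (hHs.map C), hHd, hroots,
    leadingCoeff_map_of_injective C_injective, ← C_pow, Multiset.map_map]
  have hprod0 : (0 : ℂ[X]) ∉ H.roots.map (D.eval ∘ C) := by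
    intro h
    obtain ⟨α, hα, h0⟩ := Multiset.mem_map.mp h
    have := heval α hα
    simp only [Function.comp] at h0
    simp [h0] at this
  rw [show ((-1 : ℂ[X]) ^ ((n - 1) * g.natDegree)) = C ((-1) ^ ((n - 1) * g.natDegree)) by simp,
    natDegree_C_mul (by simp),
    natDegree_C_mul (pow_ne_zero _ (leadingCoeff_ne_zero.mpr (polarPoly_ne_zero hg hn))),
    natDegree_multiset_prod _ hprod0, Multiset.map_map]
  rw [Multiset.map_congr (f := natDegree ∘ (fun x => eval x D) ∘ C) (g := fun _ => 1) rfl heval]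
  rw [Multiset.map_const', Multiset.sum_replicate, smul_eq_mul, mul_one,
    ← hHs.natDegree_eq_card_roots, natDegree_polarPoly hg hn]

/-- Resultants with prescribed sizes commute with base change, and the injection `ℝ → ℂ` preserves
the degree in `t`. -/
theorem natDegree_resultant_derivative_polarPoly {n : ℕ} {g : ℝ[X]}
    (hn : g.natDegree < n) (hsep : g.Separable) :
    (((X ^ n + C X * g.map C : ℝ[X][X]).derivative).resultant ((polarPoly n g).map C) (n - 1)
      g.natDegree).natDegree = g.natDegree := by
  have key := natDegree_resultant_derivative_polarPoly_of_complex (n := n)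
    (g := g.map Complex.ofRealHom) (by simpa using hn) (hsep.map)
  rw [natDegree_map] at key
  rw [← natDegree_map_eq_of_injective (f := Complex.ofRealHom) Complex.ofReal_injective,
    ← coe_mapRingHom, ← resultant_map_map]
  convert key using 3
  · simp [← derivative_map, Polynomial.map_map, mapRingHom_comp_C]
  · rw [← map_polarPoly, Polynomial.map_map, Polynomial.map_map, mapRingHom_comp_C]

theorem monic_X_pow_add_C_X_mul {n : ℕ} {g : ℝ[X]} (hn : g.natDegree < n) :
    (X ^ n + C X * g.map C : ℝ[X][X]).Monic ∧
      (X ^ n + C X * g.map C : ℝ[X][X]).natDegree = n := by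
  have h : (C X * g.map C : ℝ[X][X]).natDegree < n :=
    (natDegree_C_mul_le _ _).trans_lt (natDegree_map_le.trans_lt hn)
  have h' : (C X * g.map C : ℝ[X][X]).degree < n :=
    degree_le_natDegree.trans_lt (by exact_mod_cast h)
  exact ⟨monic_X_pow_add h', by rw [natDegree_add_eq_left_of_natDegree_lt (by simpa using h)]; simp⟩

theorem discr_X_pow_add_C_X_mul {n : ℕ} {g : ℝ[X]}
    (hn : g.natDegree < n) (hsep : g.Separable) :
    ∃ Q : ℝ[X], Q.natDegree = g.natDegree ∧
      (X ^ n + C X * g.map C : ℝ[X][X]).discr = X ^ (n - 1) * Q := by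
  obtain ⟨hmonic, hdeg⟩ := monic_X_pow_add_C_X_mul hn
  set f := (X ^ n + C X * g.map C : ℝ[X][X]) with hf
  have hn0 : 0 < n := by omega
  have hDd : f.derivative.natDegree ≤ n - 1 :=
    (natDegree_derivative_le _).trans (by rw [hdeg])
  have hDn : f.derivative.coeff (n - 1) = C (n : ℝ) := by
    have : f.coeff n = 1 := by simpa [hdeg] using hmonic.coeff_natDegree
    rw [coeff_derivative, Nat.sub_add_cancel hn0, this]
    push_cast [hn0]
    simp
  set H := (polarPoly n g).map (C : ℝ →+* ℝ[X]) with hH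
  have hHd : H.natDegree ≤ g.natDegree :=
    natDegree_map_le.trans (natDegree_polarPoly hsep.ne_zero hn).le
  have hrel : C (C (n : ℝ)) * f = C X * H + f.derivative * X := by
    obtain ⟨m, rfl⟩ : ∃ m, n = m + 1 := ⟨n - 1, by omega⟩
    simp [hf, hH, polarPoly, derivative_map]
    ring
  -- In `n f = t H + x f'` the multiple of `f'` drops out, and `t` comes out to the power `n - 1`,
  -- the size of `f'`. Lowering the size of `H` from `n` to `deg g` yields the power of `n`, the top
  -- coefficient of `f'`.
  have h1 : C (n : ℝ) ^ (n - 1) * f.derivative.resultant f (n - 1) n =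
      X ^ (n - 1) * (C (n : ℝ) ^ (n - g.natDegree) *
        f.derivative.resultant H (n - 1) g.natDegree) := by
    rw [← resultant_C_mul_right, hrel, resultant_add_mul_right _ _ _ _ _ (by simp; omega) hDd,
      resultant_C_mul_right, ← hDn, ← resultant_add_right_deg _ _ _ _ _ hHd,
      Nat.add_sub_cancel' hn.le]
  have h2 := resultant_deriv (f := f) (natDegree_pos_iff_degree_pos.mp (by omega))
  rw [hmonic, hdeg, resultant_comm, mul_one] at h2
  have hnC : (C (n : ℝ) : ℝ[X]) ^ (n - 1) * C ((n : ℝ)⁻¹) ^ (n - 1) = 1 := by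
    rw [← mul_pow, ← C_mul, mul_inv_cancel₀ (by positivity), C_1, one_pow]
  refine ⟨C ((-1) ^ (n * (n - 1) / 2) * (-1) ^ (n * (n - 1)) * (n : ℝ)⁻¹ ^ (n - 1) *
    (n : ℝ) ^ (n - g.natDegree)) * f.derivative.resultant H (n - 1) g.natDegree, ?_, ?_⟩
  · rw [natDegree_C_mul (by simp; omega), natDegree_resultant_derivative_polarPoly hn hsep]
  · have h3 : ((-1 : ℝ[X]) ^ (n * (n - 1) / 2)) * (-1) ^ (n * (n - 1) / 2) = 1 := by
      rw [← mul_pow]; simp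
    simp only [C_mul, C_pow, C_neg, C_1]
    linear_combination (-f.discr) * h3 - (-1 : ℝ[X]) ^ (n * (n - 1) / 2) * h2 +
      (-1 : ℝ[X]) ^ (n * (n - 1) / 2) * (-1) ^ (n * (n - 1)) * C ((n : ℝ)⁻¹) ^ (n - 1) * h1 -
      (-1 : ℝ[X]) ^ (n * (n - 1) / 2) * (-1) ^ (n * (n - 1)) *
        f.derivative.resultant f (n - 1) n * hnC

/-- The discriminant of `x ^ n + t g` vanishes at `t = ξ` when the specialisation has a multiple
root. -/
theorem eval_discr_X_pow_add_C_X_mul_eq_zero {n : ℕ} {g : ℝ[X]} (hn : g.natDegree < n) {ξ x : ℝ}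
    (hx : (X ^ n + C ξ * g).eval x = 0) (hx' : (X ^ n + C ξ * g).derivative.eval x = 0) :
    (X ^ n + C X * g.map C : ℝ[X][X]).discr.eval ξ = 0 := by
  obtain ⟨hmonic, hdeg⟩ := monic_X_pow_add_C_X_mul hn
  have h2 := resultant_deriv (f := (X ^ n + C X * g.map C : ℝ[X][X]))
    (natDegree_pos_iff_degree_pos.mp (by omega))
  have hmap : (X ^ n + C X * g.map C : ℝ[X][X]).map (evalRingHom ξ) = X ^ n + C ξ * g := by
    have : (evalRingHom ξ).comp C = RingHom.id ℝ := by ext; simp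
    simp [Polynomial.map_map, this]
  have hd : (X ^ n + C ξ * g).natDegree = n := by
    rw [← hmap, hmonic.natDegree_map, hdeg]
  have h3 : (X ^ n + C ξ * g).resultant (X ^ n + C ξ * g).derivative = 0 := by
    refine resultant_eq_zero_iff.mpr ⟨Or.inl ?_, ?_⟩
    · rw [← hmap]
      exact (hmonic.map _).ne_zero
    · rintro ⟨a, b, hab⟩
      have := congrArg (eval x) hab
      rw [eval_add, eval_mul, eval_mul, hx, hx'] at this
      simp at this
  rw [hmonic, hdeg, mul_one] at h2
  have h4 := congrArg (evalRingHom ξ) h2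
  rw [← resultant_map_map, ← derivative_map, hmap] at h4
  -- In characteristic zero the derivative has degree exactly `n - 1`, so the default sizes in `h3`
  -- match those in `h4`.
  rw [natDegree_derivative, hd] at h3
  rw [h3] at h4
  simpa using h4.symm

/-! ### Counting all real roots -/

/-- For large `t`, the real roots of `x ^ n + t g` are as many as those of `g`, together with one
near `+∞` and one near `-∞` according to the sign of the leading coefficient. -/
theorem eventually_ncard_roots_X_pow_add {n : ℕ} {g : ℝ[X]} (hn : g.natDegree < n)
    (hsep : g.Separable) :
    ∀ᶠ t in atTop, {x | (X ^ n + C t * g).eval x = 0}.ncard = {x | g.eval x = 0}.ncard +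
      (if g.leadingCoeff < 0 then 1 else 0) +
      (if (-1) ^ (n + g.natDegree) * g.leadingCoeff < 0 then 1 else 0) := by
  have hg : g ≠ 0 := hsep.ne_zero
  have hr := eventually_forall_ge_atTop.mpr (g.eventually_atTop_not_isRoot hg)
  have hgc : g.comp (-X) ≠ 0 := by
    rw [← leadingCoeff_ne_zero, leadingCoeff_comp (by simp)]
    simpa using hg
  have hl := eventually_forall_ge_atTop.mpr
    ((g.comp (-X)).eventually_atTop_not_isRoot hgc)
  obtain ⟨R, hR, hR', hrR, hlR, hR0⟩ := ((eventually_ncard_roots_Ioi n g hg hn).and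
    ((eventually_ncard_roots_Iio n g hg hn).and
      (hr.and (hl.and (eventually_gt_atTop 0))))).exists
  replace hlR : ∀ x ≤ -R, g.eval x ≠ 0 := fun x hx h => hlR (-x) (by linarith) (by simpa using h)
  replace hrR : ∀ x, R ≤ x → g.eval x ≠ 0 := hrR
  -- The pencil `g + u x^n` near `u = 0`, to be used at `u = 1 / t`; simplicity of the zeros at `u =
  -- 0` is separability of `g`.
  have hmid := eventually_ncard_roots_Icc_eq g (X ^ n) 0 (-R) R (by simpa using hlR (-R) le_rfl)
    (by simpa using hrR R le_rfl) (by
      intro x _ hx hx'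
      simp at hx hx'
      obtain ⟨a, b, hab⟩ := hsep
      have := congrArg (eval x) hab
      simp [hx, hx'] at this)
  filter_upwards [hR, hR', tendsto_inv_atTop_zero.eventually hmid, eventually_gt_atTop 0]
    with t h1 h2 h3 ht
  have h4 : {x | x ∈ Set.Icc (-R) R ∧ (g + C t⁻¹ * X ^ n).eval x = 0} =
      {x | x ∈ Set.Icc (-R) R ∧ (X ^ n + C t * g).eval x = 0} := by
    ext x
    have : (X ^ n + C t * g).eval x = t * (g + C t⁻¹ * X ^ n).eval x := by
      simp
      field_simp
      ring
    rw [Set.mem_ofPred_eq, Set.mem_ofPred_eq, this, mul_eq_zero, or_iff_right ht.ne']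
  have h5 : {x | x ∈ Set.Icc (-R) R ∧ (g + C 0 * X ^ n).eval x = 0} = {x | g.eval x = 0} := by
    ext x
    simp only [map_zero, zero_mul, add_zero, Set.mem_ofPred_eq, and_iff_right_iff_imp]
    intro hx
    constructor
    · by_contra! h
      exact hlR x h.le hx
    · by_contra! h
      exact hrR x h.le hx
  have hdeg : (C t * g).degree < n := by
    rw [degree_C_mul ht.ne']
    exact (natDegree_lt_iff_degree_lt hg).mp hn
  have hfin : {x | (X ^ n + C t * g).eval x = 0}.Finite :=
    finite_setOfPred_isRoot (monic_X_pow_add hdeg).ne_zero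
  rw [h4, h5] at h3
  have hsub : ∀ p : ℝ → Prop, {x | p x ∧ (X ^ n + C t * g).eval x = 0}.Finite :=
    fun p => hfin.subset fun x hx => hx.2
  rw [← h3, ← h1, ← h2, ← Set.ncard_union_eq _ (hsub _) (hsub _),
    ← Set.ncard_union_eq _ ((hsub _).union (hsub _)) (hsub _)]
  · congr 1
    ext x
    simp only [Set.mem_union, Set.mem_ofPred_eq, ← or_and_right]
    refine (and_iff_right ?_).symm
    by_cases h : x ∈ Set.Icc (-R) R
    · exact Or.inl (Or.inl h)
    · by_cases h' : R < x
      · exact Or.inl (Or.inr h')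
      · exact Or.inr (by by_contra h''; exact h ⟨not_lt.mp h'', not_lt.mp h'⟩)
  · rw [Set.disjoint_left]
    rintro x (hx | hx) hx'
    · exact hx'.1.not_ge hx.1.1
    · linarith [hx'.1, hx.1]
  · rw [Set.disjoint_left]
    intro x hx hx'
    exact hx'.1.not_ge hx.1.2

/-- Around each `u₀`, the real roots of `x ^ n + u g` stay in a fixed compact interval. -/
theorem exists_eventually_roots_subset_Icc {n : ℕ} {g : ℝ[X]} (hn : g.natDegree < n) (u₀ : ℝ) :
    ∃ R, ∀ᶠ u in 𝓝 u₀, ∀ x, (X ^ n + C u * g).eval x = 0 → x ∈ Set.Ioo (-R) R := by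
  have hpos : ∀ p : ℝ[X], p.natDegree < n → ∀ᶠ R in atTop, ∀ x, R ≤ x →
      (|u₀| + 1) * |p.eval x| < |x ^ n| := by
    intro p hp
    refine eventually_forall_ge_atTop.mpr ?_
    have h := isLittleO_atTop_of_degree_lt p (X ^ n : ℝ[X]) (by
      rw [degree_X_pow]
      exact degree_le_natDegree.trans_lt (by exact_mod_cast hp))
    -- `|u₀| + 2` exceeds the needed `|u₀| + 1`, giving strict inequality wherever `p` does not
    -- vanish.
    have hc : 0 < (|u₀| + 2)⁻¹ := by positivity
    filter_upwards [h.def hc, eventually_gt_atTop 0] with x hx hx0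
    rw [eval_pow, eval_X, Real.norm_eq_abs, Real.norm_eq_abs, ← div_eq_inv_mul,
      le_div_iff₀ (by positivity)] at hx
    have hxn : 0 < |x ^ n| := by positivity
    rcases (abs_nonneg (p.eval x)).eq_or_lt with h0 | h0
    · rwa [← h0, mul_zero]
    · linarith
  have hg' : (g.comp (-X)).natDegree < n := by
    rw [natDegree_comp]
    simpa using hn
  obtain ⟨R, hR, hR'⟩ := ((hpos g hn).and (hpos _ hg')).exists
  refine ⟨R, ?_⟩
  filter_upwards [Metric.ball_mem_nhds u₀ one_pos] with u hu x hx
  have hu' : |u| ≤ |u₀| + 1 := by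
    have := abs_sub_abs_le_abs_sub u u₀
    rw [Metric.mem_ball, Real.dist_eq] at hu
    linarith
  have hx0 : |x ^ n| = |u| * |g.eval x| := by
    rw [← abs_mul, ← abs_neg (u * _)]
    congr 1
    simp at hx
    linarith
  have hle : |x ^ n| ≤ (|u₀| + 1) * |g.eval x| := by
    rw [hx0]
    gcongr
  constructor
  · by_contra! h
    have := hR' (-x) (by linarith)
    simp only [eval_comp, eval_neg, eval_X, neg_neg, abs_pow, abs_neg] at this
    rw [abs_pow] at hle
    linarith
  · by_contra! h
    linarith [hR x h]

theorem eventually_ncard_roots_X_pow_add_eq {n : ℕ} {g : ℝ[X]} (hn : g.natDegree < n) (u₀ : ℝ)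
    (hsimple : ∀ x, (X ^ n + C u₀ * g).eval x = 0 → (X ^ n + C u₀ * g).derivative.eval x ≠ 0) :
    ∀ᶠ u in 𝓝 u₀, {x | (X ^ n + C u * g).eval x = 0}.ncard =
      {x | (X ^ n + C u₀ * g).eval x = 0}.ncard := by
  obtain ⟨R, hR⟩ := exists_eventually_roots_subset_Icc hn u₀
  have key := eventually_ncard_roots_Icc_eq (X ^ n) g u₀ (-R) R
    (fun h => (hR.self_of_nhds _ h).1.false) (fun h => (hR.self_of_nhds _ h).2.false)
    (fun x _ => hsimple x)
  have hset : ∀ u, (∀ x, (X ^ n + C u * g).eval x = 0 → x ∈ Set.Ioo (-R) R) →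
      {x | x ∈ Set.Icc (-R) R ∧ (X ^ n + C u * g).eval x = 0} =
        {x | (X ^ n + C u * g).eval x = 0} := by
    intro u hu
    ext x
    exact and_iff_right_of_imp fun hx => Set.Ioo_subset_Icc_self (hu x hx)
  filter_upwards [hR, key] with u hu h
  rwa [hset u hu, hset u₀ hR.self_of_nhds] at h

/-- The count is a locally constant function of `u` on the connected set `[ξ, ∞)`, so it equals its
value at large `u`. -/
theorem ncard_roots_X_pow_add_of_forall_simple {n : ℕ} {g : ℝ[X]} (hn : g.natDegree < n)
    (hsep : g.Separable) (ξ : ℝ)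
    (hsimple : ∀ u, ξ ≤ u → ∀ x, (X ^ n + C u * g).eval x = 0 →
      (X ^ n + C u * g).derivative.eval x ≠ 0) :
    {x | (X ^ n + C ξ * g).eval x = 0}.ncard = {x | g.eval x = 0}.ncard +
      (if g.leadingCoeff < 0 then 1 else 0) +
      (if (-1) ^ (n + g.natDegree) * g.leadingCoeff < 0 then 1 else 0) := by
  obtain ⟨T, hT, hξT⟩ :=
    ((eventually_ncard_roots_X_pow_add hn hsep).and (eventually_ge_atTop ξ)).exists
  rw [← hT]
  refine (isPreconnected_Ici (a := ξ)).constant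
    (f := fun u => {x | (X ^ n + C u * g).eval x = 0}.ncard) ?_ Set.self_mem_Ici hξT
  intro u hu
  refine ContinuousAt.continuousWithinAt ?_
  exact tendsto_nhds_of_eventually_eq
    (eventually_ncard_roots_X_pow_add_eq hn u (hsimple u hu))

namespace RealRootCount

theorem coeff_gPoly {s : ℕ} (c : Fin (s + 1) → ℝ) : (gPoly c).coeff s = c (Fin.last s) := by
  simp only [gPoly, finsetSum_coeff, coeff_C_mul_X_pow]
  rw [Finset.sum_eq_single (Fin.last s)]
  · simp
  · intro k _ hk
    rw [if_neg]
    intro h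
    exact hk (Fin.ext (by simpa using h.symm))
  · simp

theorem natDegree_gPoly {s : ℕ} {c : Fin (s + 1) → ℝ} (hc : c (Fin.last s) ≠ 0) :
    (gPoly c).natDegree = s := by
  refine natDegree_eq_of_le_of_coeff_ne_zero ?_ (by rwa [coeff_gPoly])
  refine natDegree_sum_le_of_forall_le _ _ fun k _ => ?_
  exact (natDegree_C_mul_X_pow_le _ _).trans (Nat.lt_succ_iff.mp k.2)

theorem fAt_eq (n : ℕ) {s : ℕ} (c : Fin (s + 1) → ℝ) (ξ : ℝ) :
    fAt n c ξ = X ^ n + C ξ * gPoly c := by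
  have : (evalRingHom ξ).comp C = RingHom.id ℝ := by ext; simp
  simp [fAt, fPoly, Polynomial.map_map, this]

end RealRootCount

/-- If `P` has no real root, the condition on `β` is vacuous and only `0 < ξ` remains; otherwise
`|β| < ξ` already implies `0 < ξ`. -/
theorem mainTheorem2 (n s : ℕ) (hs : 0 < s) (hsn : s < n) (t : Fin (s + 1) → ℝ)
    (hlead : t (Fin.last s) ≠ 0) (hsep : (RealRootCount.gPoly t).Separable) :
    (X ^ (n - 1) * RealRootCount.P n t = RealRootCount.discF n t ∧
      (RealRootCount.P n t).natDegree = s) ∧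
    ∀ ξ : ℝ, 0 < ξ →
      (∀ β : ℝ, IsGreatest {b : ℝ | (RealRootCount.P n t).eval b = 0} β → |β| < ξ) →
      (Odd (n - s) →
        RealRootCount.numRealRoots (RealRootCount.fAt n t ξ) =
          RealRootCount.numRealRoots (RealRootCount.gPoly t) + 1) ∧
      (Even (n - s) → 0 < t (Fin.last s) →
        RealRootCount.numRealRoots (RealRootCount.fAt n t ξ) =
          RealRootCount.numRealRoots (RealRootCount.gPoly t)) ∧
      (Even (n - s) → t (Fin.last s) < 0 →
        RealRootCount.numRealRoots (RealRootCount.fAt n t ξ) =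
          RealRootCount.numRealRoots (RealRootCount.gPoly t) + 2) := by
  have hdeg := RealRootCount.natDegree_gPoly hlead
  have hlc : (RealRootCount.gPoly t).leadingCoeff = t (Fin.last s) := by
    rw [leadingCoeff, hdeg, RealRootCount.coeff_gPoly]
  have hn : (RealRootCount.gPoly t).natDegree < n := by rwa [hdeg]
  obtain ⟨Q, hQ, hdisc⟩ := discr_X_pow_add_C_X_mul hn hsep
  replace hdisc : RealRootCount.discF n t = X ^ (n - 1) * Q := hdisc
  have hP : RealRootCount.P n t = Q := by
    rw [RealRootCount.P, hdisc, mul_divByMonic_cancel_left _ (monic_X_pow _)]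
  rw [hP]
  refine ⟨⟨hdisc.symm, hQ.trans hdeg⟩, fun ξ hξ hβ => ?_⟩
  have hQ0 : Q ≠ 0 := by
    rintro rfl
    rw [natDegree_zero] at hQ
    omega
  have hroot : ∀ u, ξ ≤ u → Q.eval u ≠ 0 := by
    intro u hu h
    -- A root `u ≥ ξ` would put the greatest real root at or above `ξ`.
    obtain ⟨β, hβ'⟩ := (finite_setOfPred_isRoot hQ0).isCompact.exists_isGreatest ⟨u, h⟩
    have h1 : u ≤ β := hβ'.2 h
    linarith [hβ β hβ', le_abs_self β]
  have key := ncard_roots_X_pow_add_of_forall_simple hn hsep ξ (by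
    intro u hu x hx hx'
    have h := eval_discr_X_pow_add_C_X_mul_eq_zero hn hx hx'
    have h' : (RealRootCount.discF n t).eval u = 0 := h
    rw [hdisc, eval_mul, mul_eq_zero, or_iff_left (hroot u hu)] at h'
    simp at h'
    linarith [h'.1])
  rw [hlc, hdeg] at key
  simp only [RealRootCount.numRealRoots, RealRootCount.fAt_eq]
  rw [key]
  have hpar : n + s = n - s + 2 * s := by omega
  have hpow : (-1 : ℝ) ^ (n + s) = (-1) ^ (n - s) := by
    rw [hpar, pow_add, pow_mul]
    simp
  rw [hpow]
  -- For odd `n - s` exactly one end contributes a root; for even `n - s` both do or neither does,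
  -- by the sign of `t_s`.
  refine ⟨fun h => ?_, fun h ht => ?_, fun h ht => ?_⟩
  · rw [h.neg_one_pow]
    rcases lt_or_gt_of_ne hlead with h0 | h0
    · simp [h0, h0.not_gt]
    · simp [h0, h0.not_gt]
  · simp [h.neg_one_pow, ht.not_gt]
  · simp [h.neg_one_pow, ht]
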